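/- A signed graph $\Gamma=(G,\sigma)$ consists of a finite simple graph $G$ and a map $\sigma:E(G)\to\{+1,-1\}$; its adjacency matrix has $(u,v)$ entry $\sigma(uv)$ if $uv\in E(G)$ and $0$ otherwise, and its index $\lambda_1(\Gamma)$ is the largest eigenvalue of this matrix. A cycle of $\Gamma$ is negative if the product of the signs of its edges is $-1$, and $\Gamma$ is unbalanced if it contains a negative cycle. Two signed graphs are switching equivalent if, up to an isomorphism of the underlying graphs, one is obtained from the other by reversing the signs of all edges between a set $U$ of vertices and its complement. For $n\ge 3$ let $\Gamma_1=C_3^-\bullet K_{n-2}$ be the signed graph of order $n$ obtained from the complete graph $K_{n-2}$ with all edges positive and a triangle $C_3^-$ with exactly one negative edge by identifying a vertex of $K_{n-2}$ with the vertex of $C_3^-$ whose two incident edges in $C_3^-$ are positive. Theorem. Let $\Gamma$ be an unbalanced signed graph of order $n$ and let $r$ be an integer with $4\le r\le\lfloor n/3\rfloor+1$. If $\lambda_1(\Gamma)\ge\lambda_1(\Gamma_1)$, then $\Gamma$ contains a negative cycle of length $r$, unless $\Gamma$ is switching equivalent to $\Gamma_1$. -/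

import Mathlib

/-- A signed graph `(G, σ)`: a simple graph `G` together with a sign `+1` or `-1` on each edge. -/
structure SignedGraph (V : Type*) where
  graph : SimpleGraph V
  sign : graph.edgeSet → ℤˣ

namespace SignedGraph

/-- The sign of a walk: the product of the signs of the edges it traverses. -/
def walkSign {V : Type*} (Γ : SignedGraph V) {u v : V} (p : Γ.graph.Walk u v) : ℤˣ :=
  (p.darts.map fun d => Γ.sign ⟨d.edge, d.edge_mem⟩).prod

/-- `Γ` contains a negative cycle of length `r`. -/
def HasNegativeCycle {V : Type*} (Γ : SignedGraph V) (r : ℕ) : Prop :=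
  ∃ (v : V) (p : Γ.graph.Walk v v), p.IsCycle ∧ p.length = r ∧ Γ.walkSign p = -1

/-- A signed graph is balanced if every cycle is positive. -/
def IsBalanced {V : Type*} (Γ : SignedGraph V) : Prop :=
  ∀ (v : V) (p : Γ.graph.Walk v v), p.IsCycle → Γ.walkSign p = 1

open Classical in
/-- The adjacency matrix: entry `σ(uv)` if `uv` is an edge, and `0` otherwise. -/
noncomputable def adjMatrix {V : Type*} (Γ : SignedGraph V) : Matrix V V ℝ :=
  Matrix.of fun u v =>
    if h : Γ.graph.Adj u v then (((Γ.sign ⟨s(u, v), h⟩ : ℤˣ) : ℤ) : ℝ) else 0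

/-- The index `λ₁(Γ)`, the largest eigenvalue of the adjacency matrix. The spectrum of this real
symmetric matrix is finite, and nonempty if `V` is nonempty, so that the supremum is a maximum. -/
noncomputable def index {V : Type*} [Fintype V] [DecidableEq V] (Γ : SignedGraph V) : ℝ :=
  sSup (spectrum ℝ Γ.adjMatrix)

theorem adjMatrix_isHermitian {V : Type*} (Γ : SignedGraph V) : Γ.adjMatrix.IsHermitian := by
  ext u v
  simp only [adjMatrix, Matrix.conjTranspose_apply, Matrix.of_apply, star_trivial,
    Sym2.eq_swap (a := v) (b := u)]
  by_cases h : Γ.graph.Adj u v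
  · simp [h, h.symm]
  · have h' : ¬ Γ.graph.Adj v u := fun k => h k.symm
    simp [h, h']

theorem index_isGreatest {V : Type*} [Fintype V] [DecidableEq V] [Nonempty V]
    (Γ : SignedGraph V) : IsGreatest (spectrum ℝ Γ.adjMatrix) Γ.index := by
  have h := Γ.adjMatrix_isHermitian.spectrum_real_eq_range_eigenvalues
  have hf : (spectrum ℝ Γ.adjMatrix).Finite := h ▸ Set.finite_range _
  have hne : (spectrum ℝ Γ.adjMatrix).Nonempty := h ▸ Set.range_nonempty _
  exact ⟨hne.csSup_mem hf, fun x hx => le_csSup hf.bddAbove hx⟩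

/-- Switching equivalence of signed graphs, possibly on different vertex sets: up to an isomorphism
`e` of the underlying graphs, the signs of `Γ'` arise from those of `Γ` by reversing the signs of
the edges between `{u | θ u = 1}` and `{u | θ u = -1}`. -/
def SwitchingEquivalent {V W : Type*} (Γ : SignedGraph V) (Γ' : SignedGraph W) : Prop :=
  ∃ (e : Γ.graph ≃g Γ'.graph) (θ : V → ℤˣ), ∀ (u v : V) (h : Γ.graph.Adj u v),
    Γ'.sign ⟨s(e u, e v), e.map_adj_iff.mpr h⟩ = θ u * Γ.sign ⟨s(u, v), h⟩ * θ v

/-- The signed graph `C₃⁻ • K_{n-2}` of order `n` (for `n ≥ 3`): the triangle has vertices `0, 1, 2`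
and its only negative edge is `01`; the complete graph `K_{n-2}` has vertices `2, …, n - 1`
and all of its edges are positive. -/
def triangleClique (n : ℕ) : SignedGraph (Fin n) where
  graph :=
    { Adj := fun i j => i ≠ j ∧ ((i.val ≤ 2 ∧ j.val ≤ 2) ∨ (2 ≤ i.val ∧ 2 ≤ j.val))
      symm := ⟨fun _ _ h => ⟨h.1.symm, h.2.imp And.symm And.symm⟩⟩
      loopless := ⟨fun _ h => h.1 rfl⟩ }
  sign := fun e => if (e : Sym2 (Fin n)).map Fin.val = s(0, 1) then -1 else 1

end SignedGraph

/-! Switch `Γ` so that some eigenvector `x` for the index is nonnegative, scale its maximum to `x w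
= 1`, and let `G` be the graph of the edges that are now positive. Dropping the negative entries
gives `lam * x ≤ A_G x`. As `Γ` is unbalanced, a negative edge `uv` survives; a path of length `r -
1` in `G` between `u` and `v` closes up with it to a negative cycle of length `r`. So the task is to
find paths in `G`.

The clique inside `C₃⁻ • K_{n-2}` gives `lam > n - 3`. Row `w` yields `lam + 1 ≤ ∑ x`, hence the
total deficit `∑ (1 - x i)` is less than 2: few vertices are light, while a heavy vertex has many
neighbours. This produces paths of lengths 3, 4 and 5 (`hasPathOfLength_or`) unless `w` is the only
neighbour of both `u` and `v`. Longer paths come by inserting vertices one at a time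
(`hasPathOfLength_succ`).

In the exceptional case the switched matrix is dominated entrywise by that of `C₃⁻ • K_{n-2}`. The
assumption on the index makes the Rayleigh quotient extremal, and `eq_triangleClique_adjMatrix`
turns domination into equality. -/

/-- A nonnegative vector `x` with maximal entry `x w = 1`, which is a subeigenvector of the
adjacency matrix of `G` for a value `lam` larger than `|V| - 3`. -/
structure IsLargeSubeigenvector {V : Type*} [Fintype V] (G : SimpleGraph V) [DecidableRel G.Adj]
    (x : V → ℝ) (lam : ℝ) (w : V) : Prop where
  nonneg : ∀ i, 0 ≤ x i
  le_one : ∀ i, x i ≤ 1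
  eq_one : x w = 1
  lt_lam : (Fintype.card V : ℝ) - 3 < lam
  le_sum : ∀ i, lam * x i ≤ ∑ j ∈ G.neighborFinset i, x j

/-- There is a path of length `m` from `u` to `v`. -/
def SimpleGraph.HasPathOfLength {V : Type*} (G : SimpleGraph V) (u v : V) (m : ℕ) : Prop :=
  ∃ p : G.Walk u v, p.IsPath ∧ p.length = m

theorem SimpleGraph.HasPathOfLength.symm {V : Type*} {G : SimpleGraph V} {u v : V} {m : ℕ}
    (h : G.HasPathOfLength u v m) : G.HasPathOfLength v u m := by
  obtain ⟨p, hp, hl⟩ := h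
  exact ⟨p.reverse, hp.reverse, by simpa using hl⟩

set_option linter.unusedSectionVars false

/-! ### Weights and deficits of a large subeigenvector. -/

namespace IsLargeSubeigenvector

open Finset

variable {V : Type*} [Fintype V] [DecidableEq V] {G : SimpleGraph V} [DecidableRel G.Adj]
  {x : V → ℝ} {lam : ℝ} {w u v b : V}

theorem sum_le_card (h : IsLargeSubeigenvector G x lam w) (T : Finset V) :
    ∑ i ∈ T, x i ≤ #T := by
  simpa using Finset.sum_le_card_nsmul T x 1 fun i _ => h.le_one i

theorem mul_le_sum_of_subset (h : IsLargeSubeigenvector G x lam w) {i : V} {T : Finset V}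
    (hT : ∀ j, G.Adj i j → j ∈ T) : lam * x i ≤ ∑ j ∈ T, x j :=
  (h.le_sum i).trans <| Finset.sum_le_sum_of_subset_of_nonneg
    (fun j hj => hT j (by simpa using hj)) fun j _ _ => h.nonneg j

theorem mul_le_card_of_subset (h : IsLargeSubeigenvector G x lam w) {i : V} {T : Finset V}
    (hT : ∀ j, G.Adj i j → j ∈ T) : lam * x i ≤ #T :=
  (h.mul_le_sum_of_subset hT).trans (h.sum_le_card T)

theorem lam_add_one_le (h : IsLargeSubeigenvector G x lam w) : lam + 1 ≤ ∑ i, x i := by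
  have h1 := h.mul_le_sum_of_subset (i := w) (T := univ.erase w)
    (fun j hj => by simpa using hj.ne')
  have h2 := Finset.add_sum_erase univ x (mem_univ w)
  have h3 := h.eq_one
  rw [h3] at h1 h2
  linarith

theorem card_sub_sum_le (h : IsLargeSubeigenvector G x lam w) (T : Finset V) :
    (#T : ℝ) - ∑ i ∈ T, x i ≤ Fintype.card V - ∑ i, x i := by
  have h1 : ∑ i ∈ T, (1 - x i) ≤ ∑ i, (1 - x i) :=
    Finset.sum_le_sum_of_subset_of_nonneg (subset_univ T) fun i _ _ => by linarith [h.le_one i]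
  simpa [Finset.sum_sub_distrib] using h1

/-- The deficit of all of `V` is at most `|V| - lam - 1 < 2`, and every summand `1 - x i` is
nonnegative. -/
theorem card_sub_sum_lt_two (h : IsLargeSubeigenvector G x lam w) (T : Finset V) :
    (#T : ℝ) - ∑ i ∈ T, x i < 2 := by
  linarith [h.card_sub_sum_le T, h.lam_add_one_le, h.lt_lam]

/-- A missing edge `wz` improves row `w` to `lam + 1 + x z ≤ ∑ x`. The total deficit is then below
`2 - x z`, of which `z` itself takes `1 - x z`. -/
theorem card_sub_sum_lt_one (h : IsLargeSubeigenvector G x lam w) {z : V} (hz : z ≠ w)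
    (hwz : ¬ G.Adj w z) {T : Finset V} (hT : z ∉ T) : (#T : ℝ) - ∑ i ∈ T, x i < 1 := by
  have h0 := h.card_sub_sum_le (insert z T)
  rw [card_insert_of_notMem hT, sum_insert hT] at h0
  have h1 := h.mul_le_sum_of_subset (i := w) (T := (univ.erase w).erase z)
    (fun j hj => by
      simp only [mem_erase, mem_univ, and_true]
      exact ⟨fun hj' => hwz (hj' ▸ hj), hj.ne'⟩)
  have h2 := Finset.add_sum_erase univ x (mem_univ w)
  have h3 := Finset.add_sum_erase (univ.erase w) x (a := z) (by simpa using hz)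
  have h4 := h.eq_one
  have h5 := h.lt_lam
  rw [h4] at h1 h2
  push_cast at h0
  linarith

/-- The vertex `w` has at most one further non-neighbour. -/
theorem exists_adj_of_ne (h : IsLargeSubeigenvector G x lam w) :
    ∃ w', ∀ z, z ≠ w → z ≠ w' → G.Adj w z := by
  by_contra! hc
  -- The candidate `w' = w` yields one non-neighbour `a`, and `w' = a` a second one; the degree of
  -- `w` would be at most `|V| - 3 < lam`.
  obtain ⟨a, ha, -, hwa⟩ := hc w
  obtain ⟨b, hb, hba, hwb⟩ := hc a
  have h1 := h.mul_le_card_of_subset (i := w) (T := ((univ.erase w).erase a).erase b)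
    (fun j hj => by
      simp only [mem_erase, mem_univ, and_true]
      exact ⟨fun hj' => hwb (hj' ▸ hj), fun hj' => hwa (hj' ▸ hj), hj.ne'⟩)
  have c1 := Finset.card_erase_add_one (mem_univ w)
  have c2 := Finset.card_erase_add_one (s := univ.erase w) (a := a) (by simpa using ha)
  have c3 := Finset.card_erase_add_one (s := (univ.erase w).erase a) (a := b)
    (by simp [hba, hb])
  have c4 : #(((univ.erase w).erase a).erase b) + 3 = Fintype.card V := by
    rw [← Finset.card_univ]; omega
  have c5 : (#(((univ.erase w).erase a).erase b) : ℝ) + 3 = Fintype.card V := by exact_mod_cast c4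
  rw [h.eq_one] at h1
  linarith [h.lt_lam]

/-- The sum over the closed neighbourhood dominates `(lam + 1) * x p`. -/
theorem add_one_mul_le (h : IsLargeSubeigenvector G x lam w) (p : V) :
    (lam + 1) * x p ≤ ∑ z, (if G.Adj p z ∨ z = p then x z else 0) := by
  have h1 := h.le_sum p
  have h2 : (univ.filter fun z => G.Adj p z ∨ z = p) = insert p (G.neighborFinset p) := by
    ext z; simp [or_comm]
  rw [← Finset.sum_filter, h2, sum_insert (by simp)]
  linarith

/-- If no vertex outside `T` is a common neighbour of `p` and `q`, then these have small weights. -/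
theorem add_one_mul_add_le (h : IsLargeSubeigenvector G x lam w) {p q : V} {T : Finset V}
    (hp : p ∈ T) (hq : q ∈ T) (hT : ∀ z ∉ T, ¬ (G.Adj p z ∧ G.Adj z q)) :
    (lam + 1) * (x p + x q) ≤ ∑ z, x z + ∑ z ∈ T, x z := by
  have h1 := h.add_one_mul_le p
  have h2 := h.add_one_mul_le q
  have h3 : ∑ z ∈ T, x z = ∑ z, (if z ∈ T then x z else 0) := by simp
  have h4 : ∑ z, (if G.Adj p z ∨ z = p then x z else 0) +
      ∑ z, (if G.Adj q z ∨ z = q then x z else 0) ≤ ∑ z, x z + ∑ z ∈ T, x z := by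
    rw [h3, ← Finset.sum_add_distrib, ← Finset.sum_add_distrib]
    refine Finset.sum_le_sum fun z _ => ?_
    have hz := h.nonneg z
    by_cases hzT : z ∈ T
    · rw [if_pos hzT]
      split_ifs <;> linarith
    · have hzp : z ≠ p := fun e => hzT (e ▸ hp)
      have hzq : z ≠ q := fun e => hzT (e ▸ hq)
      have := hT z hzT
      by_cases hpz : G.Adj p z
      · have : ¬ G.Adj q z := fun hqz => this ⟨hpz, hqz.symm⟩
        simp [hpz, this, hzT, hzq]
      · simp only [hpz, hzp, or_self, if_false, hzT]
        split_ifs <;> linarith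
  linarith

/-! ### Lengthening a path by one vertex. -/

/-- A path with at least six and at most `|V| / 3` vertices can be made longer by one vertex. -/
theorem hasPathOfLength_succ (h : IsLargeSubeigenvector G x lam w) {m : ℕ} (hm : 5 ≤ m)
    (hV : 3 * (m + 1) ≤ Fintype.card V) (hp : G.HasPathOfLength u v m) :
    G.HasPathOfLength u v (m + 1) := by
  obtain ⟨p, hp, hl⟩ := hp
  by_contra hno
  obtain _ | ⟨h0, p⟩ := p
  · simp at hl; omega
  obtain _ | ⟨h1, p⟩ := p
  · simp at hl; omega
  obtain _ | ⟨h2, p⟩ := p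
  · simp at hl; omega
  obtain _ | ⟨h3, p⟩ := p
  · simp at hl; omega
  obtain _ | ⟨h4, p⟩ := p
  · simp at hl; omega
  rename_i a b c d e
  set q := SimpleGraph.Walk.cons h0 (.cons h1 (.cons h2 (.cons h3 (.cons h4 p)))) with hq
  set T : Finset V := q.support.toFinset with hT
  have hTc : #T = m + 1 := by
    rw [hT, List.toFinset_card_of_nodup hp.support_nodup, SimpleGraph.Walk.length_support, hl]
  have hmem : ∀ z, z ∉ T → z ≠ u ∧ z ≠ a ∧ z ≠ b ∧ z ≠ c ∧ z ≠ d ∧ z ∉ p.support := by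
    intro z hz
    simpa [hT, hq, not_or] using hz
  simp only [hq, SimpleGraph.Walk.length_cons] at hl
  have hp' := hp
  simp only [hq, SimpleGraph.Walk.cons_isPath_iff, SimpleGraph.Walk.support_cons, List.mem_cons,
    not_or] at hp'
  obtain ⟨⟨⟨⟨⟨hpp, hd⟩, hcd, hc⟩, hbc, hbd, hb⟩, hab, hac, had, ha⟩, hua, hub, huc, hud, hu⟩ := hp'
  have he := p.start_mem_support
  -- A common neighbour outside the path of the ends of a path edge could be inserted there. This is
  -- excluded for the three disjoint edges `ua`, `bc`, `de`.
  have e1 := h.add_one_mul_add_le (p := u) (q := a) (T := T) (by simp [hT, hq]) (by simp [hT, hq])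
    (fun z hz ⟨k1, k2⟩ => hno (by
      obtain ⟨z0, z1, z2, z3, z4, z5⟩ := hmem z hz
      refine ⟨.cons k1 (.cons k2 (.cons h1 (.cons h2 (.cons h3 (.cons h4 p))))), ?_, ?_⟩
      · simp only [SimpleGraph.Walk.cons_isPath_iff, SimpleGraph.Walk.support_cons, List.mem_cons]
        grind
      · simp only [SimpleGraph.Walk.length_cons]; omega))
  have e2 := h.add_one_mul_add_le (p := b) (q := c) (T := T) (by simp [hT, hq]) (by simp [hT, hq])
    (fun z hz ⟨k1, k2⟩ => hno (by
      obtain ⟨z0, z1, z2, z3, z4, z5⟩ := hmem z hz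
      refine ⟨.cons h0 (.cons h1 (.cons k1 (.cons k2 (.cons h3 (.cons h4 p))))), ?_, ?_⟩
      · simp only [SimpleGraph.Walk.cons_isPath_iff, SimpleGraph.Walk.support_cons, List.mem_cons]
        grind
      · simp only [SimpleGraph.Walk.length_cons]; omega))
  have e3 := h.add_one_mul_add_le (p := d) (q := e) (T := T) (by simp [hT, hq]) (by simp [hT, hq])
    (fun z hz ⟨k1, k2⟩ => hno (by
      obtain ⟨z0, z1, z2, z3, z4, z5⟩ := hmem z hz
      refine ⟨.cons h0 (.cons h1 (.cons h2 (.cons h3 (.cons k1 (.cons k2 p))))), ?_, ?_⟩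
      · simp only [SimpleGraph.Walk.cons_isPath_iff, SimpleGraph.Walk.support_cons, List.mem_cons]
        grind
      · simp only [SimpleGraph.Walk.length_cons]; omega))
  have f1 := h.card_sub_sum_le T
  have f0 := h.lam_add_one_le
  have f2 := h.lt_lam
  have hn : (18 : ℝ) ≤ Fintype.card V := by exact_mod_cast (by omega : 18 ≤ Fintype.card V)
  have hTc' : 3 * (#T : ℝ) ≤ Fintype.card V := by rw [hTc]; exact_mod_cast hV
  have hS := h.sum_le_card univ
  rw [Finset.card_univ] at hS
  set six : Finset V := {u, a, b, c, d, e} with hsix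
  have hne : u ≠ e ∧ a ≠ e ∧ b ≠ e ∧ c ≠ e ∧ d ≠ e :=
    ⟨fun k => hu (k ▸ he), fun k => ha (k ▸ he), fun k => hb (k ▸ he), fun k => hc (k ▸ he),
      fun k => hd (k ▸ he)⟩
  have hsub : six ⊆ T := by
    intro z
    simp only [hsix, hT, hq, mem_insert, mem_singleton, List.mem_toFinset,
      SimpleGraph.Walk.support_cons, List.mem_cons]
    rintro (rfl | rfl | rfl | rfl | rfl | rfl) <;> simp
  have hsum : ∑ z ∈ six, x z = x u + x a + x b + x c + x d + x e := by
    rw [hsix, sum_insert, sum_insert, sum_insert, sum_insert, sum_insert, sum_singleton]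
    · ring
    all_goals simp only [mem_insert, mem_singleton]; grind
  have hcard : #six = 6 := by
    rw [hsix, card_insert_of_notMem, card_insert_of_notMem, card_insert_of_notMem,
      card_insert_of_notMem, card_insert_of_notMem, card_singleton]
    all_goals simp only [mem_insert, mem_singleton]; grind
  have f3 : ∑ z ∈ six, (1 - x z) ≤ ∑ z ∈ T, (1 - x z) :=
    Finset.sum_le_sum_of_subset_of_nonneg hsub fun i _ _ => by linarith [h.le_one i]
  simp only [Finset.sum_sub_distrib, hsum, hcard, sum_const, nsmul_eq_mul, mul_one] at f3
  set y := x u + x a + x b + x c + x d + x e with hy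
  have f4 : (lam + 1) * y ≤ 3 * (∑ z, x z + ∑ z ∈ T, x z) := by
    rw [hy]; linarith
  push_cast at f3
  generalize ∑ z, x z = S at *
  generalize ∑ z ∈ T, x z = ST at *
  generalize (Fintype.card V : ℝ) = n at *
  generalize (#T : ℝ) = k at *
  clear_value y
  -- Put `L = lam + 1`. By `f4` and `3k ≤ n`, `L(6 - y) ≥ 6L - 4n + 3(n - S) + 3(k - ST)`. Since `6
  -- - y ≤ k - ST ≤ n - S ≤ n - L`, this forces `L(n - L) ≥ 2n`, contrary to `n - L < 2` and `L ≤
  -- n`.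
  have g1 : (lam + 1 - 3) * (6 - y) ≤ (lam + 1 - 3) * (k - ST) :=
    mul_le_mul_of_nonneg_left f3 (by linarith)
  have g2 : (lam + 1 - 3) * (k - ST) ≤ (lam + 1 - 3) * (n - S) :=
    mul_le_mul_of_nonneg_left f1 (by linarith)
  have g3 : (lam + 1 - 6) * (n - S) ≤ (lam + 1 - 6) * (n - 1 - lam) :=
    mul_le_mul_of_nonneg_left (by linarith) (by linarith)
  have g4 : (lam + 1) * (n - 1 - lam) < (lam + 1) * 2 :=
    mul_lt_mul_of_pos_left (by linarith) (by linarith)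
  nlinarith

/-! ### Short paths when the heaviest vertex is an end of the negative edge. -/

/-- A set `T` of vertices of weight at most `c < 1` is small. -/
theorem card_mul_lt_two (h : IsLargeSubeigenvector G x lam w) {T : Finset V} {c : ℝ}
    (hT : ∀ i ∈ T, x i ≤ c) : (#T : ℝ) * (1 - c) < 2 := by
  have h1 := h.card_sub_sum_lt_two T
  have h2 : ∑ i ∈ T, x i ≤ #T * c := by simpa using Finset.sum_le_card_nsmul T x c hT
  linarith

/-- The case in which the heaviest vertex `u` is an end of the pair `u, v`: some neighbour of `v`
has weight at least `1 / 3`. -/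
theorem exists_third_le (h : IsLargeSubeigenvector G x lam u) (h0 : 0 ≤ lam)
    (hv : lam * x v + x u ≤ ∑ j ∈ G.neighborFinset v, x j) :
    ∃ b, G.Adj v b ∧ 1 / 3 ≤ x b := by
  by_contra! hc
  have hT : ∀ i ∈ G.neighborFinset v, x i ≤ 1 / 3 := fun i hi => (hc i (by simpa using hi)).le
  -- Fewer than three neighbours of weight at most `1 / 3` have total weight below `1 = x u`.
  have h1 := h.card_mul_lt_two hT
  have h2 : ∑ i ∈ G.neighborFinset v, x i ≤ #(G.neighborFinset v) * (1 / 3) := by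
    simpa using Finset.sum_le_card_nsmul _ x _ hT
  have h3 := mul_nonneg h0 (h.nonneg v)
  rw [h.eq_one] at hv
  linarith

/-- A vertex `b` of weight at least `1 / 3` has a neighbour outside of `{u, v}`. -/
theorem exists_adj_ne_ne (h : IsLargeSubeigenvector G x lam w) (hlam : 6 < lam)
    (hb : 1 / 3 ≤ x b) : ∃ z, G.Adj b z ∧ z ≠ u ∧ z ≠ v := by
  by_contra! hc
  have h1 := h.mul_le_card_of_subset (i := b) (T := {u, v}) (fun j hj => by
    simp only [mem_insert, mem_singleton]; have := hc j hj; tauto)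
  have h2 : (#({u, v} : Finset V) : ℝ) ≤ 2 := by exact_mod_cast Finset.card_le_two
  nlinarith

/-- If no `z` could be continued, its neighbours would lie in `{u, v, b}`, so `x z ≤ 3 / lam < 1 /
3`. The deficit allows at most two such `z`, too little for `lam * x b > 3`. -/
theorem exists_path_two (h : IsLargeSubeigenvector G x lam w) (hlam : 9 < lam)
    (hb : 1 / 3 ≤ x b) : ∃ z z', G.Adj b z ∧ z ≠ u ∧ z ≠ v ∧ G.Adj z z' ∧ z' ≠ u ∧ z' ≠ v ∧
      z' ≠ b := by
  by_contra! hc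
  set T := G.neighborFinset b \ {u, v} with hT
  have hz : ∀ z ∈ T, x z ≤ 1 / 3 := by
    intro z hz
    simp only [hT, mem_sdiff, SimpleGraph.mem_neighborFinset, mem_insert, mem_singleton,
      not_or] at hz
    have h1 := h.mul_le_card_of_subset (i := z) (T := {u, v, b}) (fun j hj => by
      simp only [mem_insert, mem_singleton]; have := hc z j hz.1 hz.2.1 hz.2.2 hj; tauto)
    have h2 : (#({u, v, b} : Finset V) : ℝ) ≤ 3 := by exact_mod_cast Finset.card_le_three
    nlinarith
  have h1 := h.card_mul_lt_two hz
  have h2 : ∑ i ∈ T, x i ≤ #T * (1 / 3) := by simpa using Finset.sum_le_card_nsmul T x _ hz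
  have h3 : #T ≤ 2 := by
    have : (#T : ℝ) < 3 := by linarith
    have : #T < 3 := by exact_mod_cast this
    omega
  have h3' : (#T : ℝ) ≤ 2 := by exact_mod_cast h3
  have h4 := h.mul_le_sum_of_subset (i := b) (T := T ∪ {u, v}) (fun j hj => by
    simp only [hT, mem_union, mem_sdiff, SimpleGraph.mem_neighborFinset, mem_insert,
      mem_singleton]; tauto)
  rw [sum_union (by simp [hT])] at h4
  have h5 := h.sum_le_card {u, v}
  have h6 : (#({u, v} : Finset V) : ℝ) ≤ 2 := by exact_mod_cast Finset.card_le_two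
  nlinarith

/-- The counting of `exists_path_two` is used twice: dead ends `z'` have weight at most `4 / lam < 1
/ 3`, which makes every `z` light, which in turn leaves `b` too few neighbours. -/
theorem exists_path_three (h : IsLargeSubeigenvector G x lam w) (hlam : 12 < lam)
    (hb : 1 / 3 ≤ x b) : ∃ z z' z'', G.Adj b z ∧ z ≠ u ∧ z ≠ v ∧ G.Adj z z' ∧ z' ≠ u ∧ z' ≠ v ∧
      z' ≠ b ∧ G.Adj z' z'' ∧ z'' ≠ u ∧ z'' ≠ v ∧ z'' ≠ b ∧ z'' ≠ z := by
  by_contra! hc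
  set T := G.neighborFinset b \ {u, v} with hT
  have hz : ∀ z ∈ T, x z ≤ 1 / 3 := by
    intro z hz
    simp only [hT, mem_sdiff, SimpleGraph.mem_neighborFinset, mem_insert, mem_singleton,
      not_or] at hz
    set T' := G.neighborFinset z \ {u, v, b} with hT'
    have hz' : ∀ z' ∈ T', x z' ≤ 1 / 3 := by
      intro z' hz'
      simp only [hT', mem_sdiff, SimpleGraph.mem_neighborFinset, mem_insert, mem_singleton,
        not_or] at hz'
      have h1 := h.mul_le_card_of_subset (i := z') (T := {u, v, b, z}) (fun j hj => by
        simp only [mem_insert, mem_singleton]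
        have := hc z z' j hz.1 hz.2.1 hz.2.2 hz'.1 hz'.2.1 hz'.2.2.1 hz'.2.2.2 hj
        tauto)
      have h2 : (#({u, v, b, z} : Finset V) : ℝ) ≤ 4 := by exact_mod_cast Finset.card_le_four
      nlinarith
    have h1 := h.card_mul_lt_two hz'
    have h2 : ∑ i ∈ T', x i ≤ #T' * (1 / 3) := by simpa using Finset.sum_le_card_nsmul T' x _ hz'
    have h3 : #T' ≤ 2 := by
      have : (#T' : ℝ) < 3 := by linarith
      have : #T' < 3 := by exact_mod_cast this
      omega
    have h3' : (#T' : ℝ) ≤ 2 := by exact_mod_cast h3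
    have h4 := h.mul_le_sum_of_subset (i := z) (T := T' ∪ {u, v, b}) (fun j hj => by
      simp only [hT', mem_union, mem_sdiff, SimpleGraph.mem_neighborFinset, mem_insert,
        mem_singleton]; tauto)
    rw [sum_union (by simp [hT'])] at h4
    have h5 := h.sum_le_card {u, v, b}
    have h6 : (#({u, v, b} : Finset V) : ℝ) ≤ 3 := by exact_mod_cast Finset.card_le_three
    nlinarith
  have h1 := h.card_mul_lt_two hz
  have h3 : #T ≤ 2 := by
    have : (#T : ℝ) < 3 := by linarith
    have : #T < 3 := by exact_mod_cast this
    omega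
  have h3' : (#T : ℝ) ≤ 2 := by exact_mod_cast h3
  have h4 := h.mul_le_card_of_subset (i := b) (T := T ∪ {u, v}) (fun j hj => by
    simp only [hT, mem_union, mem_sdiff, SimpleGraph.mem_neighborFinset, mem_insert,
      mem_singleton]; tauto)
  have h6 : #(T ∪ {u, v}) ≤ 4 := (card_union_le _ _).trans
    (by have := Finset.card_le_two (a := u) (b := v); omega)
  have h6' : (#(T ∪ {u, v}) : ℝ) ≤ 4 := by exact_mod_cast h6
  nlinarith

/-- If the heaviest vertex is an end of the negative edge, then there are short paths between the
ends of this edge. -/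
theorem hasPathOfLength_of_heaviest (h : IsLargeSubeigenvector G x lam u) (huv : u ≠ v)
    (hadj : ¬ G.Adj u v) (hv : lam * x v + x u ≤ ∑ j ∈ G.neighborFinset v, x j) {m : ℕ}
    (hm : 3 ≤ m) (hm5 : m ≤ 5) (hV : 3 * m ≤ Fintype.card V) : G.HasPathOfLength u v m := by
  have hlam : 3 * (m : ℝ) - 3 < lam := by
    have : (3 * (m : ℝ)) ≤ Fintype.card V := by exact_mod_cast hV
    linarith [h.lt_lam]
  -- `v` is the one permitted non-neighbour of `u`, so a path from `v` through `b` can be closed at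
  -- `u` from wherever it ends.
  have hu : ∀ z, z ≠ u → z ≠ v → G.Adj u z := by
    obtain ⟨w', hw'⟩ := h.exists_adj_of_ne
    have : v = w' := by
      by_contra hne
      exact hadj (hw' v huv.symm hne)
    exact this ▸ hw'
  have hm' : (3 : ℝ) ≤ m := by exact_mod_cast hm
  obtain ⟨b, hvb, hb⟩ := h.exists_third_le (by linarith) hv
  have hbv := hvb.ne'
  have hbu : b ≠ u := fun e => hadj (e ▸ hvb.symm)
  obtain rfl | rfl | rfl : m = 3 ∨ m = 4 ∨ m = 5 := by omega
  · obtain ⟨z, k1, k2, k3⟩ := h.exists_adj_ne_ne (u := u) (v := v)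
      (by norm_num at hlam; exact hlam) hb
    refine ⟨.cons (hu z k2 k3) (.cons k1.symm (.cons hvb.symm .nil)), ?_, rfl⟩
    have := k1.ne
    simp only [SimpleGraph.Walk.cons_isPath_iff, SimpleGraph.Walk.support_cons,
      SimpleGraph.Walk.support_nil, SimpleGraph.Walk.IsPath.nil, List.mem_cons, List.not_mem_nil]
    grind
  · obtain ⟨z, z', k1, k2, k3, l1, l2, l3, l4⟩ :=
      h.exists_path_two (u := u) (v := v) (by norm_num at hlam; exact hlam) hb
    refine ⟨.cons (hu z' l2 l3) (.cons l1.symm (.cons k1.symm (.cons hvb.symm .nil))), ?_, rfl⟩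
    have := k1.ne
    have := l1.ne
    simp only [SimpleGraph.Walk.cons_isPath_iff, SimpleGraph.Walk.support_cons,
      SimpleGraph.Walk.support_nil, SimpleGraph.Walk.IsPath.nil, List.mem_cons, List.not_mem_nil]
    grind
  · obtain ⟨z, z', z'', k1, k2, k3, l1, l2, l3, l4, j1, j2, j3, j4, j5⟩ :=
      h.exists_path_three (u := u) (v := v) (by norm_num at hlam; exact hlam) hb
    refine ⟨.cons (hu z'' j2 j3) (.cons j1.symm (.cons l1.symm (.cons k1.symm
      (.cons hvb.symm .nil)))), ?_, rfl⟩
    have := k1.ne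
    have := l1.ne
    have := j1.ne
    simp only [SimpleGraph.Walk.cons_isPath_iff, SimpleGraph.Walk.support_cons,
      SimpleGraph.Walk.support_nil, SimpleGraph.Walk.IsPath.nil, List.mem_cons, List.not_mem_nil]
    grind

/-! ### Short paths when the heaviest vertex is a neighbour of an end. -/

/-- If the heaviest vertex `w` is a neighbour of `u`, then a neighbour `b` of `v` which is not
joined to `w` by a short path avoiding `u` and `v` is light. -/
theorem le_half_of_not_hasPathOfLength (h : IsLargeSubeigenvector G x lam w) (huv : u ≠ v)
    (hwu : w ≠ u) (hwv : w ≠ v) (hadj : ¬ G.Adj u v) {m : ℕ} (hm : 4 ≤ m) (hm5 : m ≤ 5)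
    (hV : 3 * m ≤ Fintype.card V) (hno : ¬ G.HasPathOfLength u v m) (huw : G.Adj u w)
    (hvb : G.Adj v b) (hbw : b ≠ w) : x b ≤ 1 / 2 := by
  have hlam : 3 * (m : ℝ) - 3 < lam := by
    have : (3 * (m : ℝ)) ≤ Fintype.card V := by exact_mod_cast hV
    linarith [h.lt_lam]
  obtain ⟨w', hw'⟩ := h.exists_adj_of_ne
  have hbv := hvb.ne'
  have hbu : b ≠ u := fun e => hadj (e ▸ hvb.symm)
  obtain rfl | rfl : m = 4 ∨ m = 5 := by omega
  · norm_num at hlam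
    have h1 := h.mul_le_card_of_subset (i := b) (T := {u, v, w, w'}) (fun j hj => by
      by_contra hc
      simp only [mem_insert, mem_singleton, not_or] at hc
      obtain ⟨c1, c2, c3, c4⟩ := hc
      refine hno ⟨.cons huw (.cons (hw' j c3 c4) (.cons hj.symm (.cons hvb.symm .nil))), ?_, rfl⟩
      have := hj.ne
      simp only [SimpleGraph.Walk.cons_isPath_iff, SimpleGraph.Walk.support_cons,
        SimpleGraph.Walk.support_nil, SimpleGraph.Walk.IsPath.nil, List.mem_cons, List.not_mem_nil]
      grind)
    have h2 : (#({u, v, w, w'} : Finset V) : ℝ) ≤ 4 := by exact_mod_cast Finset.card_le_four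
    nlinarith
  · norm_num at hlam
    set T := G.neighborFinset b \ {u, v, w} with hT
    -- Here `lam > 12`, and the path avoided is `u, w, j, z, b, v`, so only five neighbours of `z`
    -- are possible.
    have hz : ∀ z ∈ T, x z ≤ 5 / 12 := by
      intro z hz
      simp only [hT, mem_sdiff, SimpleGraph.mem_neighborFinset, mem_insert, mem_singleton,
        not_or] at hz
      obtain ⟨hbz, d1, d2, d3⟩ := hz
      have h1 := h.mul_le_card_of_subset (i := z) (T := {u, v, w, w', b}) (fun j hj => by
        by_contra hc
        simp only [mem_insert, mem_singleton, not_or] at hc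
        obtain ⟨c1, c2, c3, c4, c5⟩ := hc
        refine hno ⟨.cons huw (.cons (hw' j c3 c4) (.cons hj.symm (.cons hbz.symm
          (.cons hvb.symm .nil)))), ?_, rfl⟩
        have := hj.ne
        have := hbz.ne
        simp only [SimpleGraph.Walk.cons_isPath_iff, SimpleGraph.Walk.support_cons,
          SimpleGraph.Walk.support_nil, SimpleGraph.Walk.IsPath.nil, List.mem_cons, List.not_mem_nil]
        grind)
      have h2 : (#({u, v, w, w', b} : Finset V) : ℝ) ≤ 5 := by exact_mod_cast Finset.card_le_five
      nlinarith
    have h1 := h.card_mul_lt_two hz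
    have h3 : #T ≤ 3 := by
      have : (#T : ℝ) < 4 := by linarith
      have : #T < 4 := by exact_mod_cast this
      omega
    have h4 := h.mul_le_card_of_subset (i := b) (T := T ∪ {u, v, w}) (fun j hj => by
      simp only [hT, mem_union, mem_sdiff, SimpleGraph.mem_neighborFinset, mem_insert,
        mem_singleton]; tauto)
    have h6 : #(T ∪ {u, v, w}) ≤ 6 :=
      (card_union_le _ _).trans (by have := Finset.card_le_three (a := u) (b := v) (c := w); omega)
    have h6' : (#(T ∪ {u, v, w}) : ℝ) ≤ 6 := by exact_mod_cast h6
    nlinarith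

/-- If the neighbours of `u` and `v` other than `w` are light, then there are no such neighbours. -/
theorem adj_iff_eq_of_light (h : IsLargeSubeigenvector G x lam w) (hlam : 9 < lam) (huv : u ≠ v)
    (hadj : ¬ G.Adj u v)
    (hu : lam * x u + x v ≤ ∑ j ∈ G.neighborFinset u, x j)
    (hv : lam * x v + x u ≤ ∑ j ∈ G.neighborFinset v, x j) (huw : G.Adj u w)
    (hB : ∀ b, G.Adj v b → b ≠ w → x b ≤ 1 / 2)
    (hA : G.Adj v w → ∀ a, G.Adj u a → a ≠ w → x a ≤ 1 / 2) :
    ∀ z, (G.Adj u z ↔ z = w) ∧ (G.Adj v z ↔ z = w) := by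
  have hadj' : ¬ G.Adj v u := fun k => hadj k.symm
  have xu := h.nonneg u
  have xv := h.nonneg v
  by_cases hvw : G.Adj v w
  · set K := (G.neighborFinset u ∪ G.neighborFinset v).erase w with hK
    have hwK : w ∉ K := by simp [hK]
    have hKx : ∀ i ∈ K, x i ≤ 1 / 2 := by
      intro i hi
      simp only [hK, mem_erase, mem_union, SimpleGraph.mem_neighborFinset] at hi
      obtain ⟨hi, hi' | hi'⟩ := hi
      · exact hA hvw i hi' hi
      · exact hB i hi' hi
    have huK : u ∉ K := by simp [hK, hadj']
    have hvK : v ∉ insert u K := by simp [hK, hadj, huv.symm]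
    have h1 : ∑ i ∈ K, x i ≤ #K * (1 / 2) := by simpa using Finset.sum_le_card_nsmul K x _ hKx
    have h2 := h.card_sub_sum_lt_two (insert v (insert u K))
    rw [sum_insert hvK, sum_insert huK, card_insert_of_notMem hvK, card_insert_of_notMem huK] at h2
    have h3 : ∑ j ∈ G.neighborFinset u, x j ≤ ∑ j ∈ insert w K, x j :=
      sum_le_sum_of_subset_of_nonneg (fun i hi => by
        simp only [hK, mem_insert, mem_erase, mem_union]; tauto) fun i _ _ => h.nonneg i
    have h4 : ∑ j ∈ G.neighborFinset v, x j ≤ ∑ j ∈ insert w K, x j :=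
      sum_le_sum_of_subset_of_nonneg (fun i hi => by
        simp only [hK, mem_insert, mem_erase, mem_union]; tauto) fun i _ _ => h.nonneg i
    rw [sum_insert hwK, h.eq_one] at h3 h4
    push_cast at h2
    -- The deficit gives `#K / 2 < x u + x v`, and the two rows add up to `(lam + 1) * (x u + x v) ≤
    -- 2 + #K`. Together `(lam - 1) * #K < 4`.
    have hK0 : #K = 0 := by
      by_contra hne
      have : (1 : ℝ) ≤ #K := by exact_mod_cast Nat.one_le_iff_ne_zero.mpr hne
      nlinarith
    have hKe : K = ∅ := card_eq_zero.mp hK0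
    have hKz : ∀ z, z ≠ w → ¬ G.Adj u z ∧ ¬ G.Adj v z := by
      intro z hz
      have : z ∉ K := by simp [hKe]
      simp only [hK, mem_erase, mem_union, SimpleGraph.mem_neighborFinset] at this
      tauto
    intro z
    refine ⟨⟨fun hz => ?_, fun hz => hz ▸ huw⟩, ⟨fun hz => ?_, fun hz => hz ▸ hvw⟩⟩
    · by_contra hne
      exact (hKz z hne).1 hz
    · by_contra hne
      exact (hKz z hne).2 hz
  · exfalso
    have hKx : ∀ i ∈ G.neighborFinset v, x i ≤ 1 / 2 := by
      intro i hi
      rw [SimpleGraph.mem_neighborFinset] at hi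
      exact hB i hi fun e => hvw (e ▸ hi)
    have h1 : ∑ i ∈ G.neighborFinset v, x i ≤ #(G.neighborFinset v) * (1 / 2) := by
      simpa using Finset.sum_le_card_nsmul _ x _ hKx
    have huK : u ∉ G.neighborFinset v := by simpa using hadj'
    have hvK : v ∉ insert u (G.neighborFinset v) := by simp [huv.symm]
    have h2 := h.card_sub_sum_lt_two (insert v (insert u (G.neighborFinset v)))
    rw [sum_insert hvK, sum_insert huK, card_insert_of_notMem hvK, card_insert_of_notMem huK] at h2
    push_cast at h2
    nlinarith

/-- The analogue of `adj_iff_eq_of_light` for paths of length three. -/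
theorem adj_iff_eq_of_not_hasPathOfLength_three (h : IsLargeSubeigenvector G x lam w)
    (hlam : 6 < lam) (huv : u ≠ v) (hwv : w ≠ v) (hwu : w ≠ u)
    (hadj : ¬ G.Adj u v)
    (hu : lam * x u + x v ≤ ∑ j ∈ G.neighborFinset u, x j)
    (hv : lam * x v + x u ≤ ∑ j ∈ G.neighborFinset v, x j) (huw : G.Adj u w)
    (hno : ¬ G.HasPathOfLength u v 3) :
    ∀ z, (G.Adj u z ↔ z = w) ∧ (G.Adj v z ↔ z = w) := by
  have hadj' : ¬ G.Adj v u := fun k => hadj k.symm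
  have xu := h.nonneg u
  have xv := h.nonneg v
  have hB : ∀ b, G.Adj v b → b ≠ w → ¬ G.Adj w b := by
    intro b hvb hbw hwb
    have hbu : b ≠ u := fun e => hadj (e ▸ hvb.symm)
    have := hvb.ne
    refine hno ⟨.cons huw (.cons hwb (.cons hvb.symm .nil)), ?_, rfl⟩
    simp only [SimpleGraph.Walk.cons_isPath_iff, SimpleGraph.Walk.support_cons,
      SimpleGraph.Walk.support_nil, SimpleGraph.Walk.IsPath.nil, List.mem_cons, List.not_mem_nil]
    grind
  obtain ⟨w', hw'⟩ := h.exists_adj_of_ne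
  have hB' : ∀ b, G.Adj v b → b ≠ w → b = w' := fun b hvb hbw => by
    by_contra hne
    exact hB b hvb hbw (hw' b hbw hne)
  have hvw : G.Adj v w := by
    by_contra hvw
    have hvw' : v = w' := by
      by_contra hne
      exact hvw (hw' v hwv.symm hne).symm
    have h0 : G.neighborFinset v = ∅ := by
      ext b
      simp only [SimpleGraph.mem_neighborFinset, notMem_empty, iff_false]
      intro hvb
      exact hvb.ne (hvw'.trans (hB' b hvb fun e => hvw (e ▸ hvb)).symm)
    have h2 := h.card_sub_sum_lt_two {u, v}
    rw [sum_pair huv, card_pair huv] at h2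
    rw [h0, sum_empty] at hv
    push_cast at h2
    nlinarith
  have hA : ∀ a, G.Adj u a → a ≠ w → ¬ G.Adj w a := by
    intro b hub hbw hwb
    have hbv : b ≠ v := fun e => hadj (e ▸ hub)
    have := hub.ne
    refine hno ⟨.cons hub (.cons hwb.symm (.cons hvw.symm .nil)), ?_, rfl⟩
    simp only [SimpleGraph.Walk.cons_isPath_iff, SimpleGraph.Walk.support_cons,
      SimpleGraph.Walk.support_nil, SimpleGraph.Walk.IsPath.nil, List.mem_cons, List.not_mem_nil]
    grind
  have hA' : ∀ a, G.Adj u a → a ≠ w → a = w' := fun b hvb hbw => by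
    by_contra hne
    exact hA b hvb hbw (hw' b hbw hne)
  have key : ∀ z, z ≠ w → ¬ (G.Adj u z ∨ G.Adj v z) := by
    intro z hz hor
    have hwz : ¬ G.Adj w z := hor.elim (fun k => hA z k hz) (fun k => hB z k hz)
    have hzu : z ≠ u := by rintro rfl; simp [hadj'] at hor
    have hzv : z ≠ v := by rintro rfl; simp [hadj] at hor
    -- The non-neighbour `z` of `w` forces `x u + x v > 1`, whereas the two rows, supported on `{w,
    -- w'}`, give `(lam + 1) * (x u + x v) ≤ 4`.
    have h2 := h.card_sub_sum_lt_one hz hwz (T := {u, v}) (by simp [hzu, hzv])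
    rw [sum_pair huv, card_pair huv] at h2
    have h5 := h.sum_le_card {w, w'}
    have h6 : (#({w, w'} : Finset V) : ℝ) ≤ 2 := by exact_mod_cast Finset.card_le_two
    have h3 : ∑ j ∈ G.neighborFinset u, x j ≤ ∑ j ∈ {w, w'}, x j :=
      sum_le_sum_of_subset_of_nonneg (fun i hi => by
        simp only [mem_insert, mem_singleton]
        rw [SimpleGraph.mem_neighborFinset] at hi
        have := hA' i hi; tauto) fun i _ _ => h.nonneg i
    have h4 : ∑ j ∈ G.neighborFinset v, x j ≤ ∑ j ∈ {w, w'}, x j :=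
      sum_le_sum_of_subset_of_nonneg (fun i hi => by
        simp only [mem_insert, mem_singleton]
        rw [SimpleGraph.mem_neighborFinset] at hi
        have := hB' i hi; tauto) fun i _ _ => h.nonneg i
    push_cast at h2
    nlinarith
  intro z
  refine ⟨⟨fun hz => ?_, fun hz => hz ▸ huw⟩, ⟨fun hz => ?_, fun hz => hz ▸ hvw⟩⟩
  · by_contra hne
    exact key z hne (Or.inl hz)
  · by_contra hne
    exact key z hne (Or.inr hz)

theorem hasPathOfLength_or_of_adj (h : IsLargeSubeigenvector G x lam w) (huv : u ≠ v)
    (hwv : w ≠ v) (hwu : w ≠ u) (hadj : ¬ G.Adj u v)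
    (hu : lam * x u + x v ≤ ∑ j ∈ G.neighborFinset u, x j)
    (hv : lam * x v + x u ≤ ∑ j ∈ G.neighborFinset v, x j) {m : ℕ}
    (hm : 3 ≤ m) (hm5 : m ≤ 5) (hV : 3 * m ≤ Fintype.card V) (huw : G.Adj u w) :
    G.HasPathOfLength u v m ∨ ∀ z, (G.Adj u z ↔ z = w) ∧ (G.Adj v z ↔ z = w) := by
  by_cases hno : G.HasPathOfLength u v m
  · exact Or.inl hno
  refine Or.inr ?_
  have hlam : 3 * (m : ℝ) - 3 < lam := by
    have : (3 * (m : ℝ)) ≤ Fintype.card V := by exact_mod_cast hV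
    linarith [h.lt_lam]
  rcases hm.eq_or_lt with rfl | hm4
  · exact h.adj_iff_eq_of_not_hasPathOfLength_three (by norm_num at hlam; exact hlam) huv hwv hwu
      hadj hu hv huw hno
  · have : (4 : ℝ) ≤ m := by exact_mod_cast hm4
    exact h.adj_iff_eq_of_light (by linarith) huv hadj hu hv huw
      (fun b hvb hbw => h.le_half_of_not_hasPathOfLength huv hwu hwv hadj hm4 hm5 hV hno huw hvb hbw)
      (fun hvw a hua haw => h.le_half_of_not_hasPathOfLength huv.symm hwv hwu
        (fun k => hadj k.symm) hm4 hm5 hV (fun k => hno k.symm) hvw hua haw)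

/-- The ends of a negative edge are joined by a path of any given moderate length, unless both
have the heaviest vertex as their only neighbour. -/
theorem hasPathOfLength_or (h : IsLargeSubeigenvector G x lam w) (huv : u ≠ v)
    (hadj : ¬ G.Adj u v)
    (hu : lam * x u + x v ≤ ∑ j ∈ G.neighborFinset u, x j)
    (hv : lam * x v + x u ≤ ∑ j ∈ G.neighborFinset v, x j) {m : ℕ}
    (hm : 3 ≤ m) (hV : 3 * m ≤ Fintype.card V) :
    G.HasPathOfLength u v m ∨ ∀ z, (G.Adj u z ↔ z = w) ∧ (G.Adj v z ↔ z = w) := by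
  have base : ∀ k, 3 ≤ k → k ≤ 5 → 3 * k ≤ Fintype.card V →
      G.HasPathOfLength u v k ∨ ∀ z, (G.Adj u z ↔ z = w) ∧ (G.Adj v z ↔ z = w) := by
    intro k hk hk5 hkV
    by_cases hwu : w = u
    · subst hwu
      exact Or.inl (h.hasPathOfLength_of_heaviest huv hadj hv hk hk5 hkV)
    by_cases hwv : w = v
    · subst hwv
      exact Or.inl (h.hasPathOfLength_of_heaviest huv.symm (fun k => hadj k.symm) hu hk hk5
        hkV).symm
    obtain ⟨w', hw'⟩ := h.exists_adj_of_ne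
    by_cases huw : G.Adj u w
    · exact h.hasPathOfLength_or_of_adj huv hwv hwu hadj hu hv hk hk5 hkV huw
    · have huw' : u = w' := by
        by_contra hne
        exact huw (hw' u (Ne.symm hwu) hne).symm
      have hvw : G.Adj v w := (hw' v (Ne.symm hwv) fun e => huv (huw'.trans e.symm)).symm
      exact (h.hasPathOfLength_or_of_adj huv.symm hwu hwv (fun k => hadj k.symm) hv hu hk hk5 hkV
        hvw).imp (fun p => p.symm) fun p z => (p z).symm
  induction m, hm using Nat.le_induction with
  | base => exact base 3 le_rfl (by omega) hV
  | succ m hm ih =>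
    -- Lengthening uses three disjoint edges, hence a path with six vertices, that is, `m ≥ 5`.
    rcases Nat.lt_or_ge m 5 with hm5 | hm5
    · exact base (m + 1) (by omega) (by omega) hV
    · exact (ih (by omega)).imp_left fun p => h.hasPathOfLength_succ hm5 hV p

end IsLargeSubeigenvector

/-! ### Switching and the signs of walks. -/

namespace SignedGraph

variable {V W : Type*}

theorem adjMatrix_of_adj (Γ : SignedGraph V) {i j : V} (h : Γ.graph.Adj i j) :
    Γ.adjMatrix i j = ((Γ.sign ⟨s(i, j), h⟩ : ℤ) : ℝ) := by
  simp [adjMatrix, h]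

theorem adjMatrix_of_not_adj (Γ : SignedGraph V) {i j : V} (h : ¬ Γ.graph.Adj i j) :
    Γ.adjMatrix i j = 0 := by
  simp [adjMatrix, h]

theorem adjMatrix_comm (Γ : SignedGraph V) (i j : V) : Γ.adjMatrix i j = Γ.adjMatrix j i := by
  simpa using Γ.adjMatrix_isHermitian.apply j i

theorem unit_cast_injective : Function.Injective fun t : ℤˣ => ((t : ℤ) : ℝ) := fun _ _ h =>
  Units.ext (Int.cast_injective h)

theorem adjMatrix_ne_zero_iff (Γ : SignedGraph V) {i j : V} :
    Γ.adjMatrix i j ≠ 0 ↔ Γ.graph.Adj i j := by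
  refine ⟨fun h => by_contra fun h' => h (Γ.adjMatrix_of_not_adj h'), fun h => ?_⟩
  rw [Γ.adjMatrix_of_adj h]
  exact_mod_cast (Γ.sign ⟨s(i, j), h⟩).ne_zero

/-- Signed graphs whose adjacency matrices agree after switching and relabelling. -/
theorem switchingEquivalent_of_adjMatrix {Γ : SignedGraph V} {Γ' : SignedGraph W} (e : V ≃ W)
    (θ : V → ℤˣ) (h : ∀ i j, Γ'.adjMatrix (e i) (e j) =
      ((θ i : ℤ) : ℝ) * Γ.adjMatrix i j * ((θ j : ℤ) : ℝ)) : Γ.SwitchingEquivalent Γ' := by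
  have hθ : ∀ i, ((θ i : ℤ) : ℝ) ≠ 0 := fun i => by exact_mod_cast (θ i).ne_zero
  refine ⟨⟨e, fun {i j} => ?_⟩, θ, fun i j hij => unit_cast_injective ?_⟩
  · rw [← adjMatrix_ne_zero_iff, ← adjMatrix_ne_zero_iff, h]
    simp [hθ]
  · have hij' : Γ'.graph.Adj (e i) (e j) := by
      rw [← adjMatrix_ne_zero_iff, h]
      simpa [hθ] using Γ.adjMatrix_ne_zero_iff.mpr hij
    have := h i j
    rw [Γ'.adjMatrix_of_adj hij', Γ.adjMatrix_of_adj hij] at this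
    simpa using this

theorem walkSign_cons (Γ : SignedGraph V) {a b c : V} (h : Γ.graph.Adj a b)
    (p : Γ.graph.Walk b c) :
    Γ.walkSign (.cons h p) = Γ.sign ⟨s(a, b), h⟩ * Γ.walkSign p := by
  simp [walkSign, SimpleGraph.Dart.edge]

/-- The sign of a walk in a subgraph that is switched to be positive depends on its ends only. -/
theorem walkSign_mapLe (Γ : SignedGraph V) {H : SimpleGraph V} (hle : H ≤ Γ.graph) {θ : V → ℤˣ}
    (hs : ∀ a b (h : H.Adj a b), Γ.sign ⟨s(a, b), hle h⟩ = θ a * θ b) {a b : V}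
    (p : H.Walk a b) : Γ.walkSign (p.mapLe hle) = θ a * θ b := by
  induction p with
  | nil => simp [walkSign, SimpleGraph.Walk.mapLe, Int.units_mul_self]
  | @cons a b c h p ih =>
    have : Γ.walkSign ((SimpleGraph.Walk.cons h p).mapLe hle) =
      Γ.sign ⟨s(a, b), hle h⟩ * Γ.walkSign (p.mapLe hle) := Γ.walkSign_cons (hle h) _
    rw [this, ih, hs a b h, mul_assoc, ← mul_assoc (θ b), Int.units_mul_self, one_mul]

theorem isBalanced_of_switching (Γ : SignedGraph V) {θ : V → ℤˣ}
    (hs : ∀ a b (h : Γ.graph.Adj a b), Γ.sign ⟨s(a, b), h⟩ = θ a * θ b) : Γ.IsBalanced := by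
  intro v p _
  have := Γ.walkSign_mapLe le_rfl hs p
  rw [Int.units_mul_self] at this
  convert this
  exact (SimpleGraph.Walk.map_id p).symm

/-- The sign of the path telescopes to `θ u * θ v`, opposite to that of the closing edge, which is
not on the path because it is not in `H`. -/
theorem hasNegativeCycle_of_path (Γ : SignedGraph V) {H : SimpleGraph V} (hle : H ≤ Γ.graph)
    {θ : V → ℤˣ} (hs : ∀ a b (h : H.Adj a b), Γ.sign ⟨s(a, b), hle h⟩ = θ a * θ b) {u v : V}
    (huv : Γ.graph.Adj v u) (hsuv : Γ.sign ⟨s(v, u), huv⟩ = -(θ v * θ u)) (hH : ¬ H.Adj v u)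
    {m : ℕ} (hp : H.HasPathOfLength u v m) : Γ.HasNegativeCycle (m + 1) := by
  obtain ⟨p, hp, hl⟩ := hp
  refine ⟨v, .cons huv (p.mapLe hle), ?_, by simp [SimpleGraph.Walk.mapLe, hl], ?_⟩
  · rw [SimpleGraph.Walk.cons_isCycle_iff]
    refine ⟨hp.mapLe hle, fun hmem => hH ?_⟩
    rw [SimpleGraph.Walk.edges_mapLe_eq_edges] at hmem
    exact p.adj_of_mem_edges hmem
  · rw [walkSign_cons, walkSign_mapLe Γ hle hs, hsuv, neg_mul, mul_comm (θ v),
      Int.units_mul_self]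

/-! ### The index as maximal Rayleigh quotient. -/

section Index

variable [Fintype V] [DecidableEq V]

open Matrix

theorem index_sub_mulVec (Γ : SignedGraph V) (y : V → ℝ) :
    (algebraMap ℝ (Matrix V V ℝ) Γ.index - Γ.adjMatrix) *ᵥ y =
      Γ.index • y - Γ.adjMatrix *ᵥ y := by
  rw [Matrix.sub_mulVec, Algebra.algebraMap_eq_smul_one, Matrix.smul_mulVec, Matrix.one_mulVec]

variable [Nonempty V]

theorem posSemidef_index_sub (Γ : SignedGraph V) :
    (algebraMap ℝ (Matrix V V ℝ) Γ.index - Γ.adjMatrix).PosSemidef := by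
  rw [Matrix.posSemidef_iff_isHermitian_and_spectrum_nonneg]
  refine ⟨?_, ?_⟩
  · refine Matrix.IsHermitian.sub ?_ Γ.adjMatrix_isHermitian
    rw [Matrix.algebraMap_eq_diagonal]
    exact Matrix.isHermitian_diagonal _
  · rw [← spectrum.singleton_sub_eq]
    rintro _ ⟨a, rfl, b, hb, rfl⟩
    have := Γ.index_isGreatest.2 hb
    simpa using this

theorem quadratic_le_index (Γ : SignedGraph V) (y : V → ℝ) :
    y ⬝ᵥ (Γ.adjMatrix *ᵥ y) ≤ Γ.index * (y ⬝ᵥ y) := by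
  have := Γ.posSemidef_index_sub.dotProduct_mulVec_nonneg y
  rw [index_sub_mulVec, dotProduct_sub, dotProduct_smul, star_trivial, smul_eq_mul] at this
  linarith

/-- A vector on which a positive semidefinite form vanishes lies in its kernel. -/
theorem mulVec_eq_of_index_le (Γ : SignedGraph V) (y : V → ℝ)
    (hy : Γ.index * (y ⬝ᵥ y) ≤ y ⬝ᵥ (Γ.adjMatrix *ᵥ y)) :
    Γ.adjMatrix *ᵥ y = Γ.index • y := by
  have h := (Γ.posSemidef_index_sub.dotProduct_mulVec_zero_iff y).mp (by
    rw [index_sub_mulVec, dotProduct_sub, dotProduct_smul, star_trivial, smul_eq_mul]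
    linarith [Γ.quadratic_le_index y])
  rw [index_sub_mulVec] at h
  exact (sub_eq_zero.mp h).symm

theorem exists_eigenvector (Γ : SignedGraph V) :
    ∃ y : V → ℝ, y ≠ 0 ∧ Γ.adjMatrix *ᵥ y = Γ.index • y := by
  have h := Γ.index_isGreatest.1
  rw [spectrum.mem_iff, Matrix.isUnit_iff_isUnit_det, isUnit_iff_ne_zero, not_not] at h
  obtain ⟨y, hy, h⟩ := Matrix.exists_mulVec_eq_zero_iff.mpr h
  rw [index_sub_mulVec] at h
  exact ⟨y, hy, (sub_eq_zero.mp h).symm⟩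

end Index

/-! ### The extremal graph. -/

theorem triangleClique_adjMatrix_apply {n : ℕ} (i j : Fin n) :
    (triangleClique n).adjMatrix i j =
      if i ≠ j ∧ ((i.val ≤ 2 ∧ j.val ≤ 2) ∨ (2 ≤ i.val ∧ 2 ≤ j.val)) then
        if (i.val = 0 ∧ j.val = 1) ∨ (i.val = 1 ∧ j.val = 0) then -1 else 1
      else 0 := by
  have hadj : (triangleClique n).graph.Adj i j ↔
    (i ≠ j ∧ ((i.val ≤ 2 ∧ j.val ≤ 2) ∨ (2 ≤ i.val ∧ 2 ≤ j.val))) := Iff.rfl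
  by_cases h : (triangleClique n).graph.Adj i j
  · rw [adjMatrix_of_adj _ h, if_pos (hadj.mp h)]
    simp only [triangleClique, Sym2.map_mk, Sym2.eq_iff]
    split_ifs <;> simp
  · rw [adjMatrix_of_not_adj _ h, if_neg (fun h' => h (hadj.mpr h'))]

/-- The clique alone has index `n - 3`. A small weight `s` on the two other vertices gains `4 * s`
in the quadratic form and loses only terms of order `s ^ 2`; `s = 1 / (m + 1)` is small enough. -/
theorem lt_index_triangleClique {n : ℕ} (hn : 3 ≤ n) : (n : ℝ) - 3 < (triangleClique n).index := by
  obtain ⟨m, rfl⟩ := Nat.exists_eq_add_of_le' hn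
  set s : ℝ := 1 / (m + 1) with hs
  have hm : (0 : ℝ) < m + 1 := by positivity
  have hs0 : 0 < s := by positivity
  have hs1 : s * (m + 1) = 1 := by rw [hs]; field_simp
  set y : Fin (m + 3) → ℝ := fun i => if i.val < 2 then s else 1 with hy
  have hq := (triangleClique (m + 3)).quadratic_le_index y
  have h1 : dotProduct y y = 2 * s ^ 2 + 1 + m := by
    simp only [dotProduct, hy, Fin.sum_univ_succ, Fin.val_succ, Fin.val_zero]
    norm_num
    ring
  have h3 : ∀ i : Fin m, ∑ j : Fin m, (if i.val = j.val then (0 : ℝ) else 1) = m - 1 := by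
    intro i
    have : ∀ j : Fin m, (if i.val = j.val then (0 : ℝ) else 1) = 1 - if i = j then 1 else 0 := by
      intro j; simp only [Fin.ext_iff]; split_ifs <;> simp
    simp [this]
  have h2 : dotProduct y ((triangleClique (m + 3)).adjMatrix.mulVec y) =
      m * (m + 1) + 4 * s - 2 * s ^ 2 := by
    simp only [dotProduct, Matrix.mulVec, hy, triangleClique_adjMatrix_apply, ne_eq,
      Fin.ext_iff, Fin.sum_univ_succ, Fin.val_succ, Fin.val_zero]
    norm_num
    simp [h3]
    ring
  rw [h1, h2] at hq
  push_cast
  nlinarith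

open Finset

/-- A matrix dominated by the adjacency matrix of `C₃⁻ • K_{n-2}` with at least the same index
and a nonnegative eigenvector equals this adjacency matrix. -/
theorem eq_triangleClique_adjMatrix {m : ℕ} (hm : 2 ≤ m) {B : Matrix (Fin (m + 3)) (Fin (m + 3)) ℝ}
    {z : Fin (m + 3) → ℝ} {lam : ℝ}
    (hB : ∀ i j, B i j ≤ (triangleClique (m + 3)).adjMatrix i j) (hz : ∀ i, 0 ≤ z i)
    (hz2 : z 2 = 1) (heig : ∀ i, lam * z i = ∑ j, B i j * z j)
    (hlam : (triangleClique (m + 3)).index ≤ lam) :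
    B = (triangleClique (m + 3)).adjMatrix := by
  set A := (triangleClique (m + 3)).adjMatrix with hA
  set μ := (triangleClique (m + 3)).index with hμ
  have hμ1 : (m : ℝ) < μ := by
    have := lt_index_triangleClique (n := m + 3) (by omega)
    push_cast at this
    linarith
  have hm' : (2 : ℝ) ≤ m := by exact_mod_cast hm
  have hle : ∀ i, lam * z i ≤ (A.mulVec z) i := by
    intro i
    rw [heig]
    exact Finset.sum_le_sum fun j _ => mul_le_mul_of_nonneg_right (hB i j) (hz j)
  have hzz : 0 < dotProduct z z := by
    have h1 : z 2 * z 2 ≤ ∑ i, z i * z i :=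
      Finset.single_le_sum (f := fun i => z i * z i) (fun i _ => mul_self_nonneg _) (mem_univ 2)
    rw [hz2] at h1
    exact lt_of_lt_of_le (by norm_num) h1
  have hq : lam * dotProduct z z ≤ dotProduct z (A.mulVec z) := by
    simp only [dotProduct, Finset.mul_sum]
    refine Finset.sum_le_sum fun i _ => ?_
    have := mul_le_mul_of_nonneg_left (hle i) (hz i)
    linarith
  have hq' := (triangleClique (m + 3)).quadratic_le_index z
  have hlamμ : lam = μ := le_antisymm (le_of_mul_le_mul_right (hq.trans hq') hzz) hlam
  have hAz := (triangleClique (m + 3)).mulVec_eq_of_index_le z (by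
    rw [← hμ, ← hlamμ]; exact hq)
  have hAz' : ∀ i, ∑ j, A i j * z j = μ * z i := fun i => congrFun hAz i
  have v0 : ((0 : Fin (m + 3)) : ℕ) = 0 := rfl
  have v1 : ((1 : Fin (m + 3)) : ℕ) = 1 := rfl
  have v2 : ((2 : Fin (m + 3)) : ℕ) = 2 := rfl
  have A01 : ∀ j, A 0 j = (if j = 2 then 1 else 0) - if j = 1 then 1 else 0 := by
    intro j
    rw [hA, triangleClique_adjMatrix_apply]
    simp only [Fin.ext_iff, v0, v1, v2, ne_eq]
    split_ifs <;> first | omega | (norm_num; done) | (exfalso; simp_all)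
  have A10 : ∀ j, A 1 j = (if j = 2 then 1 else 0) - if j = 0 then 1 else 0 := by
    intro j
    rw [hA, triangleClique_adjMatrix_apply]
    simp only [Fin.ext_iff, v0, v1, v2, ne_eq]
    split_ifs <;> first | omega | (norm_num; done) | (exfalso; simp_all)
  have e0 : μ * z 0 = 1 - z 1 := by
    rw [← hAz' 0]
    simp only [A01, sub_mul, ite_mul, one_mul, zero_mul, Finset.sum_sub_distrib,
      Finset.sum_ite_eq', mem_univ, if_true, hz2]
  have e1 : μ * z 1 = 1 - z 0 := by
    rw [← hAz' 1]
    simp only [A10, sub_mul, ite_mul, one_mul, zero_mul, Finset.sum_sub_distrib,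
      Finset.sum_ite_eq', mem_univ, if_true, hz2]
  have e01 : z 0 = z 1 := by
    have : (μ - 1) * (z 0 - z 1) = 0 := by linarith
    rcases mul_eq_zero.mp this with h | h <;> linarith
  -- The negative entry of `A` rules out a direct appeal to Perron–Frobenius. Instead `z 0 = z 1`
  -- with `(μ + 1) * z 0 = 1`, and each further vertex is a neighbour of `2`, where `z` is 1.
  have hpos : ∀ i, 0 < z i := by
    intro i
    by_cases h0 : i = 0
    · rw [h0]; by_contra! hc; nlinarith [hz 0]
    by_cases h1 : i = 1
    · rw [h1]; by_contra! hc; nlinarith [hz 1]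
    by_cases h2 : i = 2
    · rw [h2, hz2]; norm_num
    have hi : 3 ≤ i.val := by
      simp only [Fin.ext_iff, v0, v1, v2] at h0 h1 h2
      omega
    have hA0 : ∀ j, 0 ≤ A i j := by
      intro j
      rw [hA, triangleClique_adjMatrix_apply]
      split_ifs <;> first | omega | norm_num
    have hA2 : A i 2 = 1 := by
      rw [hA, triangleClique_adjMatrix_apply, if_pos, if_neg]
      · omega
      · exact ⟨h2, Or.inr ⟨by omega, by omega⟩⟩
    have h3 : A i 2 * z 2 ≤ ∑ j, A i j * z j :=
      Finset.single_le_sum (f := fun j => A i j * z j)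
        (fun j _ => mul_nonneg (hA0 j) (hz j)) (mem_univ 2)
    rw [hA2, hz2, hAz' i] at h3
    by_contra! hc
    nlinarith [hz i]
  ext i j
  -- Both matrices have eigenvector `z` for the same value; nonnegative terms with positive `z j`
  -- then force `A = B`.
  have hsum : ∑ j, (A i j - B i j) * z j = 0 := by
    simp only [sub_mul, Finset.sum_sub_distrib, hAz', ← heig, hlamμ, sub_self]
  have h0 := (Finset.sum_eq_zero_iff_of_nonneg (fun j _ =>
    mul_nonneg (sub_nonneg.mpr (hB i j)) (hz j))).mp hsum j (mem_univ j)
  rcases mul_eq_zero.mp h0 with h | h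
  · linarith
  · exact absurd h (hpos j).ne'

/-! ### Normalising the eigenvector and labelling the vertices. -/

/-- After switching, the index has a nonnegative eigenvector with maximal entry `1`. -/
theorem exists_switching_eigenvector [Fintype V] [DecidableEq V] [Nonempty V]
    (Γ : SignedGraph V) :
    ∃ (θ : V → ℤˣ) (x : V → ℝ) (w : V), (∀ i, 0 ≤ x i) ∧ (∀ i, x i ≤ 1) ∧ x w = 1 ∧
      ∀ i, Γ.index * x i =
        ∑ j, ((θ i : ℤ) : ℝ) * Γ.adjMatrix i j * ((θ j : ℤ) : ℝ) * x j := by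
  obtain ⟨y, hy, h⟩ := Γ.exists_eigenvector
  obtain ⟨w, hw⟩ := Finite.exists_max fun i => |y i|
  have hw0 : 0 < |y w| := by
    obtain ⟨i, hi⟩ := Function.ne_iff.mp hy
    exact (abs_pos.mpr hi).trans_le (hw i)
  set θ : V → ℤˣ := fun i => if 0 ≤ y i then 1 else -1 with hθ
  have h1 : ∀ i, |y i| = ((θ i : ℤ) : ℝ) * y i := by
    intro i
    by_cases hi : 0 ≤ y i
    · simp [hθ, hi, abs_of_nonneg]
    · simp [hθ, hi, abs_of_neg (not_le.mp hi)]
  have h2 : ∀ i, ((θ i : ℤ) : ℝ) * ((θ i : ℤ) : ℝ) = 1 := by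
    intro i
    by_cases hi : 0 ≤ y i <;> simp [hθ, hi]
  refine ⟨θ, fun i => |y i| / |y w|, w, fun i => by positivity,
    fun i => (div_le_one hw0).mpr (hw i), div_self hw0.ne', fun i => ?_⟩
  have h3 : ∑ j, Γ.adjMatrix i j * y j = Γ.index * y i := congrFun h i
  have h4 : ∀ j, ((θ i : ℤ) : ℝ) * Γ.adjMatrix i j * ((θ j : ℤ) : ℝ) * (|y j| / |y w|) =
      ((θ i : ℤ) : ℝ) / |y w| * (Γ.adjMatrix i j * y j) := by
    intro j
    rw [h1 j]
    linear_combination ((θ i : ℤ) : ℝ) * Γ.adjMatrix i j * y j / |y w| * h2 j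
  rw [Finset.sum_congr rfl fun j _ => h4 j, ← Finset.mul_sum, h3]
  simp only [h1 i]
  ring

theorem exists_equiv_fin [Fintype V] {m : ℕ} (hV : Fintype.card V = m + 3) {u v w : V}
    (huv : u ≠ v) (huw : u ≠ w) (hvw : v ≠ w) :
    ∃ e : V ≃ Fin (m + 3), e u = 0 ∧ e v = 1 ∧ e w = 2 := by
  have h01 : (0 : Fin (m + 3)) ≠ 1 := by simp
  have h02 : (0 : Fin (m + 3)) ≠ 2 := by
    intro h; exact absurd (congrArg Fin.val h) (by change ¬ (0 = 2); decide)
  have h12 : (1 : Fin (m + 3)) ≠ 2 := by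
    intro h; exact absurd (congrArg Fin.val h) (by change ¬ (1 = 2); decide)
  set e0 := Fintype.equivFinOfCardEq hV
  set e1 := e0.trans (Equiv.swap (e0 u) 0) with he1
  have a1 : e1 u = 0 := by simp [he1]
  set e2 := e1.trans (Equiv.swap (e1 v) 1) with he2
  have a2 : e2 u = 0 := by
    rw [he2, Equiv.trans_apply, a1, Equiv.swap_apply_of_ne_of_ne _ h01]
    rw [← a1]; exact e1.injective.ne huv
  have b2 : e2 v = 1 := by simp [he2]
  refine ⟨e2.trans (Equiv.swap (e2 w) 2), ?_, ?_, by simp⟩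
  · rw [Equiv.trans_apply, a2, Equiv.swap_apply_of_ne_of_ne _ h02]
    rw [← a2]; exact e2.injective.ne huw
  · rw [Equiv.trans_apply, b2, Equiv.swap_apply_of_ne_of_ne _ h12]
    rw [← b2]; exact e2.injective.ne hvw

end SignedGraph

/-! ### Proof of the main theorem. -/

theorem mainTheorem1 {V : Type*} [Fintype V] [DecidableEq V] (Γ : SignedGraph V) (n r : ℕ)
    (hn : Fintype.card V = n) (hΓ : ¬ Γ.IsBalanced)
    (hr : 4 ≤ r) (hrn : r ≤ n / 3 + 1)
    (hindex : (SignedGraph.triangleClique n).index ≤ Γ.index) :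
    Γ.HasNegativeCycle r ∨ Γ.SwitchingEquivalent (SignedGraph.triangleClique n) := by
  classical
  have hn9 : 9 ≤ n := by omega
  have : Nonempty V := Fintype.card_pos_iff.mp (by omega)
  have hlam : (n : ℝ) - 3 < Γ.index :=
    (SignedGraph.lt_index_triangleClique (by omega)).trans_le hindex
  obtain ⟨θ, x, w, hx0, hx1, hxw, heig⟩ := Γ.exists_switching_eigenvector
  set B : V → V → ℝ := fun i j => ((θ i : ℤ) : ℝ) * Γ.adjMatrix i j * ((θ j : ℤ) : ℝ) with hB
  have heig' : ∀ i, Γ.index * x i = ∑ j, B i j * x j := heig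
  have hBsymm : ∀ i j, B i j = B j i := by
    intro i j
    simp only [hB, Γ.adjMatrix_comm i j]
    ring
  have hB0 : ∀ i j, ¬ Γ.graph.Adj i j → B i j = 0 := by
    intro i j h
    simp [hB, Γ.adjMatrix_of_not_adj h]
  have hBadj : ∀ i j (h : Γ.graph.Adj i j),
      B i j = (((θ i * Γ.sign ⟨s(i, j), h⟩ * θ j : ℤˣ) : ℤ) : ℝ) := by
    intro i j h
    simp [hB, Γ.adjMatrix_of_adj h]
  have hθ : ∀ i j (h : Γ.graph.Adj i j),
      (B i j = 1 ∧ Γ.sign ⟨s(i, j), h⟩ = θ i * θ j) ∨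
        (B i j = -1 ∧ Γ.sign ⟨s(i, j), h⟩ = -(θ i * θ j)) := by
    intro i j h
    rw [hBadj i j h]
    rcases Int.units_eq_one_or (θ i) with h1 | h1 <;>
      rcases Int.units_eq_one_or (θ j) with h2 | h2 <;>
      rcases Int.units_eq_one_or (Γ.sign ⟨s(i, j), h⟩) with h3 | h3 <;> simp [h1, h2, h3]
  obtain ⟨G, hG⟩ : ∃ G : SimpleGraph V, ∀ i j, G.Adj i j ↔ B i j = 1 :=
    ⟨{ Adj := fun i j => B i j = 1
       symm := ⟨fun i j h => (hBsymm j i).trans h⟩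
       loopless := ⟨fun i h => by
         rw [hB0 i i (Γ.graph.loopless.irrefl i)] at h
         exact zero_ne_one h⟩ }, fun _ _ => Iff.rfl⟩
  have hBle : ∀ i j, B i j ≤ if G.Adj i j then 1 else 0 := by
    intro i j
    by_cases h : Γ.graph.Adj i j
    · rcases hθ i j h with ⟨h1, -⟩ | ⟨h1, -⟩
      · rw [if_pos ((hG i j).mpr h1), h1]
      · rw [h1]; split_ifs <;> norm_num
    · rw [hB0 i j h]; split_ifs <;> norm_num
  have hle : G ≤ Γ.graph := by
    intro i j h
    by_contra h'
    rw [hG, hB0 i j h'] at h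
    exact zero_ne_one h
  have hs : ∀ a b (h : G.Adj a b), Γ.sign ⟨s(a, b), hle h⟩ = θ a * θ b := by
    intro a b h
    rcases hθ a b (hle h) with ⟨-, h1⟩ | ⟨h1, -⟩
    · exact h1
    · rw [hG] at h; linarith
  have hsumG : ∀ i, ∑ j ∈ G.neighborFinset i, x j = ∑ j, if G.Adj i j then x j else 0 := by
    intro i
    rw [← Finset.sum_filter]
    exact Finset.sum_congr (by ext; simp) fun _ _ => rfl
  have hL : IsLargeSubeigenvector G x Γ.index w :=
    { nonneg := hx0
      le_one := hx1
      eq_one := hxw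
      lt_lam := by rw [hn]; exact hlam
      le_sum := fun i => by
        rw [heig', hsumG]
        refine Finset.sum_le_sum fun j _ => ?_
        have := mul_le_mul_of_nonneg_right (hBle i j) (hx0 j)
        simpa using this }
  -- Unlike the subeigenvector inequality, this keeps the contribution `-x j` of one negative edge.
  have hneg : ∀ i j, B i j = -1 →
      Γ.index * x i + x j ≤ ∑ k ∈ G.neighborFinset i, x k := by
    intro i j hij
    have h1 : x j = ∑ k, if k = j then x k else 0 := by simp
    rw [heig', hsumG, h1, ← Finset.sum_add_distrib]
    refine Finset.sum_le_sum fun k _ => ?_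
    by_cases hk : k = j
    · subst hk
      rw [hij, if_pos rfl]
      have := hx0 k
      split_ifs <;> linarith
    · have := mul_le_mul_of_nonneg_right (hBle i k) (hx0 k)
      simpa [hk] using this
  obtain ⟨u, v, huv, hBuv, hsuv⟩ : ∃ u v, ∃ h : Γ.graph.Adj v u, B v u = -1 ∧
      Γ.sign ⟨s(v, u), h⟩ = -(θ v * θ u) := by
    by_contra! hc
    refine hΓ (Γ.isBalanced_of_switching (θ := θ) fun a b h => ?_)
    rcases hθ a b h with ⟨-, h1⟩ | ⟨h1, h2⟩
    · exact h1
    · exact absurd h2 (hc b a h h1)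
  have hGvu : ¬ G.Adj v u := by rw [hG, hBuv]; norm_num
  have hne : u ≠ v := huv.ne'
  have hcore := hL.hasPathOfLength_or hne (fun h => hGvu h.symm)
    (hneg u v ((hBsymm u v).trans hBuv)) (hneg v u hBuv) (m := r - 1) (by omega) (by omega)
  rcases hcore with hp | hw
  · left
    have := Γ.hasNegativeCycle_of_path hle hs huv hsuv hGvu hp
    rwa [Nat.sub_add_cancel (by omega)] at this
  · right
    obtain ⟨m, rfl⟩ := Nat.exists_eq_add_of_le' (show 3 ≤ n by omega)
    have huw : u ≠ w := (((hw w).1.mpr rfl)).ne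
    have hvw : v ≠ w := (((hw w).2.mpr rfl)).ne
    obtain ⟨e, eu, ev, ew⟩ := SignedGraph.exists_equiv_fin hn hne huw hvw
    have v0 : ((0 : Fin (m + 3)) : ℕ) = 0 := rfl
    have v1 : ((1 : Fin (m + 3)) : ℕ) = 1 := rfl
    have v2 : ((2 : Fin (m + 3)) : ℕ) = 2 := rfl
    have ku : ∀ i, (e i).val = 0 ↔ i = u := fun i => by
      rw [← v0, ← Fin.ext_iff, ← eu, e.injective.eq_iff]
    have kv : ∀ i, (e i).val = 1 ↔ i = v := fun i => by
      rw [← v1, ← Fin.ext_iff, ← ev, e.injective.eq_iff]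
    have kw : ∀ i, (e i).val = 2 ↔ i = w := fun i => by
      rw [← v2, ← Fin.ext_iff, ← ew, e.injective.eq_iff]
    -- With `u, v, w` placed at `0, 1, 2`, the edges of `G` at `u` and `v` lead only to `w`, and all
    -- others lie within the clique; the entry `-1` at `uv` matches the negative edge `01`.
    have hdom : ∀ i j, B i j ≤ (SignedGraph.triangleClique (m + 3)).adjMatrix (e i) (e j) := by
      intro i j
      rw [SignedGraph.triangleClique_adjMatrix_apply]
      split_ifs with c1 c2
      · rcases c2 with ⟨c, d⟩ | ⟨c, d⟩
        · rw [(ku i).mp c, (kv j).mp d, hBsymm, hBuv]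
        · rw [(kv i).mp c, (ku j).mp d, hBuv]
      · refine (hBle i j).trans ?_
        split_ifs <;> norm_num
      · refine (hBle i j).trans (le_of_eq (if_neg fun hij => c1 ⟨e.injective.ne hij.ne, ?_⟩))
        by_contra hc
        have hi := ku i
        have hj := ku j
        have hi' := kv i
        have hj' := kv j
        have hi2 := kw i
        have hj2 := kw j
        rcases Nat.lt_or_ge (e i).val 2 with hlt | hge
        · have : j = w := by
            rcases (show (e i).val = 0 ∨ (e i).val = 1 by omega) with h0 | h0
            · exact (hw j).1.mp (hi.mp h0 ▸ hij)
            · exact (hw j).2.mp (hi'.mp h0 ▸ hij)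
          have := hj2.mpr this
          omega
        · rcases Nat.lt_or_ge (e j).val 2 with hlt' | hge'
          · have : i = w := by
              rcases (show (e j).val = 0 ∨ (e j).val = 1 by omega) with h0 | h0
              · exact (hw i).1.mp (hj.mp h0 ▸ hij.symm)
              · exact (hw i).2.mp (hj'.mp h0 ▸ hij.symm)
            have := hi2.mpr this
            omega
          · omega
    have hfin := SignedGraph.eq_triangleClique_adjMatrix (m := m) (by omega)
      (B := Matrix.of fun i j => B (e.symm i) (e.symm j)) (z := fun i => x (e.symm i))
      (lam := Γ.index) (fun i j => by simpa using hdom (e.symm i) (e.symm j))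
      (fun i => hx0 _) (by rw [← ew]; simpa using hxw)
      (fun i => by
        rw [heig', ← Equiv.sum_comp e.symm]
        rfl) hindex
    refine SignedGraph.switchingEquivalent_of_adjMatrix e θ fun i j => ?_
    rw [← hfin]
    simp [hB]
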